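/- **Setting.** Losses are functions $\ell:[0,1]\times\{0,1\}\to\mathbb R$ (they do not depend on features). Write $\partial\ell(\hat y)=\ell(\hat y,1)-\ell(\hat y,0)$. For each loss under consideration let $\pi_\ell:[0,1]\to[0,1]$ be a post-processing function, i.e. $\pi_\ell(p)$ is an arbitrary member of $\operatorname{argmin}_{\hat y\in[0,1]}\,\{p\,\ell(\hat y,1)+(1-p)\,\ell(\hat y,0)\}$ for every $p\in[0,1]$ (the minimum is assumed to be attained). A kernel $k$ on $[0,1]$ (symmetric, positive semidefinite) with reproducing kernel Hilbert space $\mathcal F_k$ is *$\mathcal L$-kernel decision OI* (KDOI) with parameter $B$ if $\partial\ell\circ\pi_\ell\in\mathcal F_k$ for all $\ell\in\mathcal L$, both suprema below are finite, and $$\sqrt{\ \sup_{\ell\in\mathcal L}\|\partial\ell\circ\pi_\ell\|_{\mathcal F_k}^2\cdot\sup_{p\in[0,1]}k(p,p)\ }\le B .$$ Let $W^{1,2}_1([0,1])$ be the set of continuous $g:[0,1]\to[-1,1]$ that are differentiable on $(0,1)$ with $\int_0^1 g^2+\int_0^1 (g')^2\le 1$. Let * $\mathcal L_{\mathrm{PS}}$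 be the set of losses $\ell$ such that $p\in\operatorname{argmin}_{\hat y}\{p\,\ell(\hat y,1)+(1-p)\,\ell(\hat y,0)\}$ for all $p\in[0,1]$ and $\partial\ell\in W^{1,2}_1([0,1])$ (smooth proper scoring rules); * $\mathcal L_{\mathrm{SC}}$, for $\gamma>0$, be the set of losses with values in $[-1,1]$ such that, for each $y\in\{0,1\}$, $\ell(\cdot,y)$ is continuous and $\gamma$-strongly convex on $[0,1]$, and differentiable on $(0,1)$ with $|\tfrac{d}{d\hat y}\ell(\hat y,y)|\le 1$; * $\mathcal L_m=\{\ell_1,\dots,\ell_m\}$, $m\ge 1$, be any losses for which the minima defining $\pi_{\ell_i}$ are attained, and for which $|\partial\ell_i(\hat y)|\le M$ for all $i$ and $\hat y$. Running times count the steps of a program in exact real arithmetic: constants in $\mathbb Q$, $+,-,\times,\div$, $\exp$, comparisons, loops over $i=1,\dots,m$ and black-box evaluations of $\ell_i$ and $\pi_{\ell_i}$ each cost one step. **Proposition.** There are kernels $k_{\mathrm{PS}}$ and $k_{\mathrm{SC}}$, independent of $\gamma$ and computable in a constant number of steps without any black box, and there is a universal constant $C$, such that the following hold for every choice of the $\pi_\ell$.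 1. $k_{\mathrm{PS}}$ is $\mathcal L_{\mathrm{PS}}$-KDOI with parameter $\sqrt3$. 2. For every $\gamma>0$, $k_{\mathrm{SC}}$ is $\mathcal L_{\mathrm{SC}}$-KDOI with parameter $2\sqrt3\,(3+2\gamma^{-1})$. 3. For every $m\ge1$ and $\mathcal L_m$ as above there is a kernel $k_m$, computed by one fixed program (the same for all $m$ and all losses) in at most $Cm$ steps, that is $\mathcal L_m$-KDOI with parameter $M\sqrt m$; hence with parameter $m$ whenever $M\le\sqrt m$ (for instance if $M=1$, as for $[0,1]$-valued losses). Moreover, if $M\le2$ (for instance for $[-1,1]$-valued $\ell_1,\dots,\ell_m$), then for every $\gamma>0$ and $\mathcal L=\mathcal L_{\mathrm{PS}}\cup\mathcal L_{\mathrm{SC}}\cup\mathcal L_m$ the kernel $k=k_{\mathrm{PS}}+k_{\mathrm{SC}}+k_m$, which is also computed by one fixed program in at most $Cm$ steps, is $\mathcal L$-KDOI with parameter $4\sqrt{3m}\,(2+\gamma^{-1})$. -/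

import Mathlib

noncomputable section

namespace KernelOI

open Set MeasureTheory

/-! ### Kernels and their reproducing kernel Hilbert spaces -/

/-- A real (positive semidefinite) kernel on a set `X`. -/
structure PDKernel (X : Type*) where
  toFun : X → X → ℝ
  symm : ∀ x y, toFun x y = toFun y x
  psd : ∀ (n : ℕ) (x : Fin n → X) (c : Fin n → ℝ),
    0 ≤ ∑ i, ∑ j, c i * c j * toFun (x i) (x j)

namespace PDKernel

variable {X : Type*}

instance : CoeFun (PDKernel X) (fun _ => X → X → ℝ) := ⟨PDKernel.toFun⟩

/-- The sum of two kernels. -/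
instance : Add (PDKernel X) where
  add k₁ k₂ :=
    { toFun := fun x y => k₁ x y + k₂ x y
      symm := fun x y => by rw [k₁.symm x y, k₂.symm x y]
      psd := fun n x c => by
        simpa [mul_add, Finset.sum_add_distrib] using add_nonneg (k₁.psd n x c) (k₂.psd n x c) }

/-- The scalar kernel `k`, seen as a matrix of operators on the one-dimensional space `ℝ`
(multiplication by `k x y`), which is the form in which Mathlib's RKHS theory takes it. -/
def toMatrix (k : PDKernel X) : Matrix X X (ℝ →L[ℝ] ℝ) :=
  Matrix.of fun x y => k x y • ContinuousLinearMap.id ℝ ℝ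

theorem posSemidef_toMatrix (k : PDKernel X) : k.toMatrix.PosSemidef := by
  have tfae := (RKHS.posSemidef_tfae (K := k.toMatrix)).out 0 2
  refine tfae.mpr ⟨?_, fun v => ?_⟩
  · ext x y
    have hid : star (ContinuousLinearMap.id ℝ ℝ) = ContinuousLinearMap.id ℝ ℝ := star_one _
    simp [toMatrix, Matrix.conjTranspose_apply, k.symm x y, hid]
  · have h := k.psd v.support.card (fun i => (v.support.equivFin.symm i : X))
      (fun i => v (v.support.equivFin.symm i : X))
    have e : ∀ g : X → ℝ,
        ∑ i : Fin v.support.card, g (v.support.equivFin.symm i : X) = ∑ x ∈ v.support, g x := by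
      intro g
      rw [← Finset.sum_coe_sort v.support g]
      exact Equiv.sum_comp v.support.equivFin.symm (fun a : v.support => g a)
    rw [e (fun x => ∑ j, v x * v (v.support.equivFin.symm j : X) *
      k x (v.support.equivFin.symm j : X))] at h
    simp_rw [fun x => e (fun y => v x * v y * k x y)] at h
    simp only [Finsupp.sum, RCLike.re_to_real]
    refine h.trans_eq (Finset.sum_congr rfl fun x _ => Finset.sum_congr rfl fun y _ => ?_)
    simp only [toMatrix, Matrix.of_apply, k.symm y x]
    simp
    ring

instance (k : PDKernel X) : Fact k.toMatrix.PosSemidef := ⟨k.posSemidef_toMatrix⟩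

/-- The reproducing kernel Hilbert space `𝓕_k` of the kernel `k` (Moore–Aronszajn). Its elements
coerce to functions `X → ℝ`, and the coercion is injective. -/
abbrev Space (k : PDKernel X) : Type _ := RKHS.OfKernel k.toMatrix

end PDKernel

/-! ### Losses, post-processing, kernel decision OI -/

/-- Feature-invariant losses `ℓ(ŷ, y)`, with `ŷ ∈ [0,1]` and `y ∈ {0,1}` (`true` is `1`). -/
abbrev Loss : Type := unitInterval → Bool → ℝ

/-- The discrete derivative `∂ℓ(ŷ) = ℓ(ŷ,1) - ℓ(ŷ,0)`. -/
def discDeriv (l : Loss) (yhat : unitInterval) : ℝ := l yhat true - l yhat false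

/-- The expected loss `E_{y ∼ Ber(p)} ℓ(ŷ,y)` of the decision `ŷ`. -/
def risk (l : Loss) (p yhat : unitInterval) : ℝ :=
  (p : ℝ) * l yhat true + (1 - (p : ℝ)) * l yhat false

/-- `argmin_{ŷ ∈ [0,1]} E_{y ∼ Ber(p)} ℓ(ŷ,y)`, as a set. -/
def argminRisk (l : Loss) (p : unitInterval) : Set unitInterval :=
  {yhat | ∀ z, risk l p yhat ≤ risk l p z}

/-- `π` assigns to every loss `ℓ ∈ 𝓛` a post-processing function `π_ℓ`, that is, `π_ℓ(p)` is an
arbitrary member of the argmin set. -/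
def IsPostProcessing (π : Loss → unitInterval → unitInterval) (L : Set Loss) : Prop :=
  ∀ l ∈ L, ∀ p, π l p ∈ argminRisk l p

/-- The squared norms, in the RKHS of `k`, of the functions `∂ℓ ∘ π_ℓ` with `ℓ ∈ 𝓛`. -/
def composedNormSq (k : PDKernel unitInterval) (L : Set Loss)
    (π : Loss → unitInterval → unitInterval) : Set ℝ :=
  {r | ∃ l ∈ L, ∃ F : k.Space, (⇑F = fun p => discDeriv l (π l p)) ∧ r = ‖F‖ ^ 2}

/-- Kernel decision OI with parameter `B`: all `∂ℓ ∘ π_ℓ` lie in the RKHS of `k`, their norms and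
the feature norms are bounded, and `√(sup ‖∂ℓ ∘ π_ℓ‖² · sup k(p,p)) ≤ B`. -/
structure KDOI (k : PDKernel unitInterval) (L : Set Loss)
    (π : Loss → unitInterval → unitInterval) (B : ℝ) : Prop where
  mem : ∀ l ∈ L, ∃ F : k.Space, ⇑F = fun p => discDeriv l (π l p)
  bdd_norm : BddAbove (composedNormSq k L π)
  bdd_feature : BddAbove (range fun p => k p p)
  bound : √(sSup (composedNormSq k L π) * sSup (range fun p => k p p)) ≤ B

/-! ### The loss classes -/

/-- A function on `[0,1]`, extended to `ℝ` by constants, in order to take derivatives in `(0,1)`. -/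
def extendReal (g : unitInterval → ℝ) : ℝ → ℝ := IccExtend (zero_le_one (α := ℝ)) g

/-- `W^{1,2}_B([0,1])`: the continuous, differentiable functions `g : [0,1] → [-1,1]` with
`∫ g² + ∫ (g')² ≤ B²` (in particular `g'` is square integrable). -/
def sobolevBall (B : ℝ) : Set (unitInterval → ℝ) :=
  {g | Continuous g ∧ (∀ t, |g t| ≤ 1) ∧ DifferentiableOn ℝ (extendReal g) (Ioo 0 1) ∧
    IntegrableOn (fun t => deriv (extendReal g) t ^ 2) (Ioo 0 1) ∧
    (∫ t in Ioo (0 : ℝ) 1, extendReal g t ^ 2) +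
      (∫ t in Ioo (0 : ℝ) 1, deriv (extendReal g) t ^ 2) ≤ B ^ 2}

/-- Smooth proper scoring rules. -/
def lossPS : Set Loss :=
  {l | (∀ p, p ∈ argminRisk l p) ∧ discDeriv l ∈ sobolevBall 1}

/-- Continuous, differentiable, `γ`-strongly convex losses with values in `[-1,1]` and derivative
(in `ŷ`) bounded by `1`. -/
def lossSC (γ : ℝ) : Set Loss :=
  {l | ∀ y, Continuous (fun yhat => l yhat y) ∧ (∀ yhat, |l yhat y| ≤ 1) ∧
    StrongConvexOn (Icc 0 1) γ (extendReal fun yhat => l yhat y) ∧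
    DifferentiableOn ℝ (extendReal fun yhat => l yhat y) (Ioo 0 1) ∧
    ∀ t ∈ Ioo (0 : ℝ) 1, |deriv (extendReal fun yhat => l yhat y) t| ≤ 1}

/-! ### Programs with a step count -/

/-- Programs for computing a kernel value `k(p,q)` by exact real arithmetic. A program may
loop over a finite list of losses `ℓ_i`, and inside the loop query, as black boxes, the current loss
`ℓ_i` and its post-processing function `π_{ℓ_i}`. -/
inductive Prog : Type
  | argL : Prog
  | argR : Prog
  | const : ℚ → Prog
  | add : Prog → Prog → Prog
  | sub : Prog → Prog → Prog
  | mul : Prog → Prog → Prog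
  | div : Prog → Prog → Prog
  | exp : Prog → Prog
  | ifLe : Prog → Prog → Prog → Prog → Prog
  | loss : Bool → Prog → Prog
  | post : Prog → Prog
  | sumLosses : Prog → Prog

/-- Clamp a real number to `[0,1]`, the domain of the black boxes. -/
def clamp (a : ℝ) : unitInterval := projIcc 0 1 zero_le_one a

/-- Run a program on the input `(p,q)`, for the losses `l i` and post-processing functions `w i`,
`i < m`. The result is the value together with the number of steps: every executed instruction
(arithmetic operation, exponential, comparison, black-box query, loop iteration) counts one step.
The argument of type `Option (Fin m)` is the loop index; a query outside every loop returns `0`. -/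
def Prog.run {m : ℕ} (l : Fin m → Loss) (w : Fin m → unitInterval → unitInterval) (p q : ℝ) :
    Prog → Option (Fin m) → ℝ × ℕ
  | .argL, _ => (p, 1)
  | .argR, _ => (q, 1)
  | .const c, _ => ((c : ℝ), 1)
  | .add a b, i =>
      ((a.run l w p q i).1 + (b.run l w p q i).1, (a.run l w p q i).2 + (b.run l w p q i).2 + 1)
  | .sub a b, i =>
      ((a.run l w p q i).1 - (b.run l w p q i).1, (a.run l w p q i).2 + (b.run l w p q i).2 + 1)
  | .mul a b, i =>
      ((a.run l w p q i).1 * (b.run l w p q i).1, (a.run l w p q i).2 + (b.run l w p q i).2 + 1)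
  | .div a b, i =>
      ((a.run l w p q i).1 / (b.run l w p q i).1, (a.run l w p q i).2 + (b.run l w p q i).2 + 1)
  | .exp a, i => (Real.exp (a.run l w p q i).1, (a.run l w p q i).2 + 1)
  | .ifLe a b s t, i =>
      open Classical in
      let r := if (a.run l w p q i).1 ≤ (b.run l w p q i).1 then s.run l w p q i
        else t.run l w p q i
      (r.1, (a.run l w p q i).2 + (b.run l w p q i).2 + r.2 + 1)
  | .loss y a, i =>
      (i.elim 0 fun j => l j (clamp (a.run l w p q i).1) y, (a.run l w p q i).2 + 1)
  | .post a, i =>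
      (i.elim 0 fun j => (w j (clamp (a.run l w p q i).1) : ℝ), (a.run l w p q i).2 + 1)
  | .sumLosses a, _ =>
      (∑ j : Fin m, (a.run l w p q (some j)).1, (∑ j : Fin m, ((a.run l w p q (some j)).2 + 1)) + 1)

/-- With black-box access to the losses `l i` and post-processing functions `w i`, the program `P`
computes the kernel `k`, in at most `N` steps on every input. -/
def Prog.Computes {m : ℕ} (P : Prog) (l : Fin m → Loss) (w : Fin m → unitInterval → unitInterval)
    (k : PDKernel unitInterval) (N : ℕ) : Prop :=
  ∀ p q : unitInterval, (P.run l w p q none).1 = k p q ∧ (P.run l w p q none).2 ≤ N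

/-- The kernel `k` is computed by a program without any black box in at most `N` steps. -/
def ComputableInSteps (k : PDKernel unitInterval) (N : ℕ) : Prop :=
  ∃ P : Prog, P.Computes (m := 0) (fun i => i.elim0) (fun i => i.elim0) k N

end KernelOI

end

open KernelOI

/-!
The kernels are `k_PS(x,y) = 3/4 - |x - y| / 2`, `k_SC = 4 k_PS` and, for a finite family of
losses, `k_m(x,y) = ∑ i, f i x * f i y` with `f i = ∂ℓ_i ∘ π_{ℓ_i}`.

Membership in a reproducing kernel Hilbert space is reduced to kernel values: `f` lies in the space
of `k` with `‖f‖² ≤ D` as soon as `2 ∑ c_i f(x_i) ≤ D + ∑ c_i c_j k(x_i,x_j)` for all finite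
families of points and coefficients (`PDKernel.NormSqLe.exists_space`). In this form, adding another
kernel preserves the bound, and no Hilbert space of features has to be constructed. Kernel decision
OI follows from such norm bounds and a bound of the diagonal (`KDOI.of_normSqLe`).

With `φ_x = 1/2` to the left of `x` and `-1/2` to the right of it, `k_PS(x,y) = 1/2 + ∫ φ_x φ_y`,
and `f x = (f 0 + f 1) / 2 + ∫ φ_x f'` by the fundamental theorem of calculus. Young's inequality
then yields `‖f‖² ≤ 2 B² + ∫ (f')²` for `|f| ≤ B` (`absKernel_normSqLe`).

* For a smooth proper scoring rule, `∂ℓ ∘ π_ℓ = ∂ℓ` whatever the choice of `π_ℓ`, by uniqueness of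
  supergradients (`discDeriv_eq_of_mem_argminRisk`). Hence `‖∂ℓ ∘ π_ℓ‖² ≤ 3`, while
  `k_PS(p,p) = 3/4`.
* For a `γ`-strongly convex loss, `π_ℓ` is `2/γ`-Lipschitz (`abs_sub_le_of_mem_argminRisk`), so
  `∂ℓ ∘ π_ℓ` is `4/γ`-Lipschitz and bounded by `2`, and its squared norm for `k_SC` is at most
  `(8 + 16/γ²) / 4`, while `k_SC(p,p) = 3`.
* For the finite family, `f i` has norm at most `1` and `k_m(p,p) ≤ m M²`.

For the sum kernel the squared norms are at most `4/γ² + 3` and the diagonal is at most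
`3/4 + 3 + 4m ≤ (31/4) m`. The weight `4` in `k_SC` is there for this step: it lowers the coefficient
of `γ⁻²` in the product to `31 m`, below the admissible `48 m`, where weight `1` would give `88 m`.
-/

noncomputable section

namespace KernelOI

open Set MeasureTheory

/-! ### Membership in a reproducing kernel Hilbert space -/

namespace PDKernel

variable {X : Type*}

/-- `k.NormSqLe f D` says that `f` lies in the reproducing kernel Hilbert space of `k` with
`‖f‖² ≤ D`, in a form that only mentions kernel values: the functional `k(x,·) ↦ f x` satisfies
`2 ⟨f, g⟩ ≤ D + ‖g‖²` on all `g = ∑ cᵢ k(xᵢ,·)`. By homogeneity in `c` this is the same as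
`⟨f, g⟩² ≤ D ‖g‖²`. -/
def NormSqLe (k : PDKernel X) (f : X → ℝ) (D : ℝ) : Prop :=
  ∀ (n : ℕ) (x : Fin n → X) (c : Fin n → ℝ),
    2 * ∑ i, c i * f (x i) ≤ D + ∑ i, ∑ j, c i * c j * k (x i) (x j)

theorem add_apply (k₁ k₂ : PDKernel X) (x y : X) : (k₁ + k₂) x y = k₁ x y + k₂ x y := rfl

theorem NormSqLe.mono {k : PDKernel X} {f : X → ℝ} {D D' : ℝ} (h : k.NormSqLe f D)
    (hD : D ≤ D') : k.NormSqLe f D' :=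
  fun n x c => (h n x c).trans (by gcongr)

theorem NormSqLe.add_right {k₁ : PDKernel X} {f : X → ℝ} {D : ℝ} (h : k₁.NormSqLe f D)
    (k₂ : PDKernel X) : (k₁ + k₂).NormSqLe f D := fun n x c => by
  have h₁ := h n x c
  have h₂ := k₂.psd n x c
  simp only [add_apply, mul_add, Finset.sum_add_distrib]
  linarith

theorem NormSqLe.add_left {k₂ : PDKernel X} {f : X → ℝ} {D : ℝ} (h : k₂.NormSqLe f D)
    (k₁ : PDKernel X) : (k₁ + k₂).NormSqLe f D := fun n x c => by
  have h₁ := h n x c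
  have h₂ := k₁.psd n x c
  simp only [add_apply, mul_add, Finset.sum_add_distrib]
  linarith

/-- The kernel function `k(x,·)`, as an element of the reproducing kernel Hilbert space. -/
def feature (k : PDKernel X) (x : X) : k.Space := RKHS.kerFun k.Space x (1 : ℝ)

theorem inner_feature (k : PDKernel X) (x : X) (F : k.Space) :
    inner ℝ (k.feature x) F = F x := by
  simp [feature]

theorem inner_feature_feature (k : PDKernel X) (x y : X) :
    inner ℝ (k.feature x) (k.feature y) = k x y := by
  rw [inner_feature, feature, RKHS.kerFun_apply, RKHS.OfKernel.kernel_ofKernel]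
  simp [toMatrix]

/-- The span of the kernel functions, parametrized by finitely supported coefficients. -/
def featureSum (k : PDKernel X) : (X →₀ ℝ) →ₗ[ℝ] k.Space :=
  Finsupp.linearCombination ℝ k.feature

theorem denseRange_featureSum (k : PDKernel X) : DenseRange k.featureSum := by
  have h := RKHS.kerFun_dense (𝕜 := ℝ) k.Space
  rw [DenseRange, ← LinearMap.coe_range, ← Submodule.dense_iff_topologicalClosure_eq_top] at *
  refine h.mono ?_
  rw [featureSum, Finsupp.range_linearCombination, SetLike.coe_subset_coe, Submodule.span_le]
  rintro _ ⟨x, v, rfl⟩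
  have : RKHS.kerFun k.Space x v = v • k.feature x := by
    rw [feature, ← map_smul]; simp
  rw [this]
  exact Submodule.smul_mem _ _ (Submodule.subset_span ⟨x, rfl⟩)

theorem norm_featureSum_sq (k : PDKernel X) (c : X →₀ ℝ) :
    ‖k.featureSum c‖ ^ 2 = ∑ x ∈ c.support, ∑ y ∈ c.support, c x * c y * k x y := by
  rw [← real_inner_self_eq_norm_sq, featureSum, Finsupp.linearCombination_apply, Finsupp.sum,
    sum_inner]
  refine Finset.sum_congr rfl fun x _ => ?_
  rw [inner_sum]
  refine Finset.sum_congr rfl fun y _ => ?_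
  rw [real_inner_smul_left, real_inner_smul_right, inner_feature_feature]
  ring

/-- A function that satisfies `NormSqLe` is represented by an element of the space: the functional
extends from the dense span of the kernel functions, and Fréchet–Riesz represents the extension. -/
theorem NormSqLe.exists_space {k : PDKernel X} {f : X → ℝ} {D : ℝ} (h : k.NormSqLe f D) :
    ∃ F : k.Space, ⇑F = f ∧ ‖F‖ ^ 2 ≤ D := by
  have hD : 0 ≤ D := by simpa using h 0 Fin.elim0 Fin.elim0
  let T : (X →₀ ℝ) →ₗ[ℝ] ℝ := Finsupp.linearCombination ℝ f
  have hT : ∀ c, 2 * T c ≤ D + ‖k.featureSum c‖ ^ 2 := by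
    intro c
    have e : ∀ g : X → ℝ, ∑ i : Fin c.support.card, g (c.support.equivFin.symm i : X) =
        ∑ x ∈ c.support, g x := by
      intro g
      rw [← Finset.sum_coe_sort c.support g]
      exact Equiv.sum_comp c.support.equivFin.symm (fun a : c.support => g a)
    have h' := h c.support.card (fun i => (c.support.equivFin.symm i : X))
      (fun i => c (c.support.equivFin.symm i : X))
    rw [e (fun x => c x * f x), e (fun x => ∑ j, c x * c (c.support.equivFin.symm j : X) *
      k x (c.support.equivFin.symm j : X))] at h'
    simp_rw [fun x => e (fun y => c x * c y * k x y)] at h'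
    rw [norm_featureSum_sq]
    simpa [T, Finsupp.linearCombination_apply, Finsupp.sum] using h'
  have hbound : ∀ c, ‖T c‖ ≤ √D * ‖k.featureSum c‖ := by
    intro c
    -- the bound for all multiples `t • c` is a nonnegative quadratic polynomial in `t`
    have hdisc := discrim_le_zero (a := ‖k.featureSum c‖ ^ 2) (b := -2 * T c) (c := D) fun t => by
      have := hT (t • c)
      simp only [map_smul, norm_smul, smul_eq_mul, mul_pow, Real.norm_eq_abs, sq_abs] at this
      nlinarith
    refine abs_le_of_sq_le_sq ?_ (by positivity)
    rw [mul_pow, Real.sq_sqrt hD]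
    rw [discrim] at hdisc
    nlinarith
  let Φ : k.Space →L[ℝ] ℝ := T.extendOfNorm k.featureSum
  refine ⟨(InnerProductSpace.toDual ℝ k.Space).symm Φ, ?_, ?_⟩
  · funext x
    rw [← inner_feature, real_inner_comm, InnerProductSpace.toDual_symm_apply]
    have hx : k.featureSum (Finsupp.single x 1) = k.feature x := by simp [featureSum]
    have hΦ : Φ (k.featureSum (Finsupp.single x 1)) = T (Finsupp.single x 1) :=
      LinearMap.extendOfNorm_eq k.denseRange_featureSum ⟨_, hbound⟩ _
    rw [← hx, hΦ]
    simp [T]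
  · rw [LinearIsometryEquiv.norm_map]
    calc ‖Φ‖ ^ 2 ≤ √D ^ 2 := by
          gcongr
          exact LinearMap.opNorm_extendOfNorm_le k.denseRange_featureSum (Real.sqrt_nonneg D) hbound
      _ = D := Real.sq_sqrt hD

end PDKernel

/-- Kernel decision OI from uniform bounds on the norms and on the diagonal of the kernel. -/
theorem KDOI.of_normSqLe {k : PDKernel unitInterval} {L : Set Loss}
    {π : Loss → unitInterval → unitInterval} {B D S : ℝ}
    (h : ∀ l ∈ L, k.NormSqLe (fun p => discDeriv l (π l p)) D) (hD : 0 ≤ D)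
    (hk : ∀ p, k p p ≤ S) (hB : 0 ≤ B) (hDS : D * S ≤ B ^ 2) : KDOI k L π B := by
  have hle : ∀ r ∈ composedNormSq k L π, r ≤ D := by
    rintro r ⟨l, hl, F, hF, rfl⟩
    obtain ⟨G, hG, hGD⟩ := (h l hl).exists_space
    rwa [DFunLike.coe_injective (hF.trans hG.symm)]
  have hS : ∀ r ∈ range fun p => k p p, r ≤ S := by rintro r ⟨p, rfl⟩; exact hk p
  have hdiag : ∀ p, 0 ≤ k p p := fun p => by
    simpa using k.psd 1 (fun _ => p) (fun _ => 1)
  refine ⟨fun l hl => ?_, ⟨D, hle⟩, ⟨S, hS⟩, ?_⟩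
  · obtain ⟨F, hF, -⟩ := (h l hl).exists_space
    exact ⟨F, hF⟩
  · refine Real.sqrt_le_iff.mpr ⟨hB, le_trans ?_ hDS⟩
    refine mul_le_mul (Real.sSup_le hle hD) (csSup_le (range_nonempty _) hS) ?_ hD
    exact Real.sSup_nonneg (by rintro r ⟨p, rfl⟩; exact hdiag p)

/-! ### A first-order Sobolev kernel on the unit interval -/

/-- The step function `t ↦ ±1/2` jumping at `x`. These are the derivatives of the
functions `-|x - ·| / 2`, away from `x`. -/
def halfStep (x t : ℝ) : ℝ := if t ≤ x then 1 / 2 else -1 / 2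

theorem measurable_halfStep (x : ℝ) : Measurable (halfStep x) :=
  Measurable.ite measurableSet_Iic measurable_const measurable_const

theorem norm_halfStep_le (x t : ℝ) : ‖halfStep x t‖ ≤ 1 / 2 := by
  unfold halfStep
  split_ifs <;> norm_num

theorem integrableOn_halfStep_mul {h : ℝ → ℝ} (hh : IntegrableOn h (Ioc 0 1)) (x : ℝ) :
    IntegrableOn (fun t => halfStep x t * h t) (Ioc 0 1) :=
  hh.bdd_mul (measurable_halfStep x).aestronglyMeasurable
    (Filter.Eventually.of_forall (norm_halfStep_le x))

theorem integrableOn_halfStep (x : ℝ) : IntegrableOn (halfStep x) (Ioc 0 1) := by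
  simpa using integrableOn_halfStep_mul (h := fun _ => 1) (by simp) x

theorem integral_halfStep_mul_halfStep (x y : unitInterval) :
    ∫ t in Ioc (0 : ℝ) 1, halfStep x t * halfStep y t = 1 / 4 - |(x : ℝ) - y| / 2 := by
  wlog hxy : (x : ℝ) ≤ y generalizing x y
  · simpa [mul_comm, abs_sub_comm] using this y x (le_of_not_ge hxy)
  have hfun : ∀ t, halfStep x t * halfStep y t =
      1 / 4 - (Ioc (x : ℝ) y).indicator (fun _ => (1 / 2 : ℝ)) t := by
    intro t
    simp only [halfStep, indicator, mem_Ioc]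
    split_ifs <;> grind
  have hinter : Ioc (0 : ℝ) 1 ∩ Ioc (x : ℝ) y = Ioc (x : ℝ) y :=
    inter_eq_right.mpr (Ioc_subset_Ioc x.2.1 y.2.2)
  have hint : IntegrableOn ((Ioc (x : ℝ) y).indicator fun _ => (1 / 2 : ℝ)) (Ioc 0 1) :=
    Integrable.indicator (by simp) measurableSet_Ioc
  simp_rw [hfun]
  rw [integral_sub (by simp) hint, setIntegral_indicator measurableSet_Ioc, hinter]
  simp [abs_of_nonpos (sub_nonpos.mpr hxy), hxy]
  ring

theorem integral_halfStep_mul {h : ℝ → ℝ} (hh : IntegrableOn h (Ioc 0 1)) (x : unitInterval) :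
    ∫ t in Ioc (0 : ℝ) 1, halfStep x t * h t =
      (∫ t in Ioc (0 : ℝ) x, h t) - (∫ t in Ioc (0 : ℝ) 1, h t) / 2 := by
  have hfun : ∀ t, halfStep x t * h t = (Iic (x : ℝ)).indicator h t - h t / 2 := by
    intro t
    simp only [halfStep, indicator, mem_Iic]
    split_ifs <;> ring
  simp_rw [hfun]
  rw [integral_sub (Integrable.indicator hh measurableSet_Iic) (hh.div_const 2),
    setIntegral_indicator measurableSet_Iic, Ioc_inter_Iic, min_eq_right x.2.2, integral_div]

theorem sum_halfStep_quadratic {n : ℕ} (x : Fin n → unitInterval) (c : Fin n → ℝ) (a : ℝ) :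
    ∑ i, ∑ j, c i * c j * (a * (3 / 4 - |(x i : ℝ) - x j| / 2)) =
      a * (1 / 2 * (∑ i, c i) ^ 2 +
        ∫ t in Ioc (0 : ℝ) 1, (∑ i, c i * halfStep (x i) t) ^ 2) := by
  have hint : ∀ i j, IntegrableOn
      (fun t => c i * halfStep (x i) t * (c j * halfStep (x j) t)) (Ioc 0 1) := fun i j => by
    have := ((integrableOn_halfStep_mul (integrableOn_halfStep (x j)) (x i)).const_mul (c i * c j))
    refine this.congr (Filter.Eventually.of_forall fun t => ?_)
    simp only
    ring
  simp_rw [sq, Finset.sum_mul_sum]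
  rw [integral_finsetSum _ fun i _ => integrable_finsetSum _ fun j _ => hint i j]
  simp_rw [integral_finsetSum _ fun j _ => hint _ j]
  rw [Finset.mul_sum, ← Finset.sum_add_distrib, Finset.mul_sum]
  refine Finset.sum_congr rfl fun i _ => ?_
  rw [Finset.mul_sum, ← Finset.sum_add_distrib, Finset.mul_sum]
  refine Finset.sum_congr rfl fun j _ => ?_
  simp_rw [mul_mul_mul_comm]
  rw [integral_const_mul, integral_halfStep_mul_halfStep]
  ring

/-- The kernel `a (3/4 - |x - y| / 2)` on `[0,1]`. Its squared norm is
`(1/a) (2 ((f 0 + f 1) / 2)² + ∫ (f')²)`. The constant `3/4` minimizes the product of the diagonal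
of the kernel with the largest squared norm of an `f` such that `|f| ≤ 1` and `∫ (f')² ≤ 1`. -/
def absKernel (a : ℕ) : PDKernel unitInterval where
  toFun x y := a * (3 / 4 - |(x : ℝ) - y| / 2)
  symm x y := by rw [abs_sub_comm]
  psd n x c := by
    rw [sum_halfStep_quadratic]
    have : 0 ≤ ∫ t in Ioc (0 : ℝ) 1, (∑ i, c i * halfStep (x i) t) ^ 2 :=
      integral_nonneg fun t => sq_nonneg _
    positivity

theorem absKernel_apply (a : ℕ) (x y : unitInterval) :
    absKernel a x y = a * (3 / 4 - |(x : ℝ) - y| / 2) := rfl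

/-- Norm bound in the space of `absKernel`, for a function `f` that is the integral of a square
integrable function `h`. It rests on `f x = (f 0 + f 1) / 2 + ∫ halfStep x * h`. -/
theorem absKernel_normSqLe {a : ℕ} (ha : 0 < a) {f : unitInterval → ℝ} {h : ℝ → ℝ} {B D : ℝ}
    (hh : IntegrableOn h (Ioc 0 1)) (hsq : IntegrableOn (fun t => h t ^ 2) (Ioc 0 1))
    (hftc : ∀ x : unitInterval, ∫ t in Ioc (0 : ℝ) x, h t = f x - f 0)
    (hB : ∀ x, |f x| ≤ B) (hD : (2 * B ^ 2 + ∫ t in Ioc (0 : ℝ) 1, h t ^ 2) ≤ a * D) :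
    (absKernel a).NormSqLe f D := by
  intro n x c
  have ha' : (0 : ℝ) < a := by exact_mod_cast ha
  set g : ℝ → ℝ := fun t => ∑ i, c i * halfStep (x i) t with hg
  set s : ℝ := ∑ i, c i
  have hrep : ∀ y : unitInterval,
      f y = (f 0 + f 1) / 2 + ∫ t in Ioc (0 : ℝ) 1, halfStep y t * h t := by
    intro y
    have h1 := hftc 1
    rw [Icc.coe_one] at h1
    rw [integral_halfStep_mul hh, hftc, h1]
    ring
  have hint : ∀ i, IntegrableOn (fun t => c i * (halfStep (x i) t * h t)) (Ioc 0 1) := fun i =>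
    (integrableOn_halfStep_mul hh (x i)).const_mul (c i)
  have hgh : ∀ t, g t * h t = ∑ i, c i * (halfStep (x i) t * h t) := fun t => by
    simp [hg, Finset.sum_mul, mul_assoc]
  have hsum : ∑ i, c i * f (x i) = s * ((f 0 + f 1) / 2) + ∫ t in Ioc (0 : ℝ) 1, g t * h t := by
    simp_rw [hgh]
    rw [integral_finsetSum _ fun i _ => hint i]
    simp_rw [integral_const_mul]
    rw [Finset.sum_mul, ← Finset.sum_add_distrib]
    exact Finset.sum_congr rfl fun i _ => by rw [hrep (x i)]; ring
  have hgm : Measurable g :=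
    Finset.measurable_fun_sum _ fun i _ => (measurable_halfStep (x i)).const_mul (c i)
  have hgsq : IntegrableOn (fun t => g t ^ 2) (Ioc 0 1) := by
    refine Integrable.of_bound (hgm.pow_const 2).aestronglyMeasurable ((∑ i, |c i| * (1 / 2)) ^ 2)
      (Filter.Eventually.of_forall fun t => ?_)
    rw [norm_pow]
    gcongr
    refine (norm_sum_le _ _).trans (Finset.sum_le_sum fun i _ => ?_)
    rw [norm_mul, Real.norm_eq_abs (c i)]
    gcongr
    exact norm_halfStep_le _ _
  have hghint : IntegrableOn (fun t => g t * h t) (Ioc 0 1) := by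
    simp_rw [hgh]
    exact integrable_finsetSum _ fun i _ => hint i
  have hyoung : 2 * ∫ t in Ioc (0 : ℝ) 1, g t * h t ≤
      (∫ t in Ioc (0 : ℝ) 1, h t ^ 2) / a + a * ∫ t in Ioc (0 : ℝ) 1, g t ^ 2 := by
    rw [← integral_const_mul, ← integral_const_mul, ← integral_div,
      ← integral_add (hsq.div_const _) (hgsq.const_mul _)]
    refine integral_mono (hghint.const_mul 2) ((hsq.div_const _).add (hgsq.const_mul _))
      fun t => ?_
    have : h t ^ 2 / a + a * g t ^ 2 - 2 * (g t * h t) = (h t - a * g t) ^ 2 / a := by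
      field_simp
      ring
    have : 0 ≤ (h t - a * g t) ^ 2 / a := by positivity
    simp only
    linarith
  have hmid : 2 * (s * ((f 0 + f 1) / 2)) ≤ 2 * B ^ 2 / a + a * (1 / 2 * s ^ 2) := by
    have h0 := abs_le.mp (hB 0)
    have h1 := abs_le.mp (hB 1)
    have hm : ((f 0 + f 1) / 2) ^ 2 ≤ B ^ 2 := sq_le_sq' (by linarith) (by linarith)
    generalize (f 0 + f 1) / 2 = m at hm
    have : 2 * m ^ 2 / a + a * (1 / 2 * s ^ 2) - 2 * (s * m) = (2 * m - a * s) ^ 2 / (2 * a) := by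
      field_simp
      ring
    have : 0 ≤ (2 * m - a * s) ^ 2 / (2 * a) := by positivity
    have : 2 * m ^ 2 / a ≤ 2 * B ^ 2 / a := by gcongr
    linarith
  have hD' : 2 * B ^ 2 / a + (∫ t in Ioc (0 : ℝ) 1, h t ^ 2) / a ≤ D := by
    rw [← add_div, div_le_iff₀ ha']
    linarith
  simp only [absKernel_apply]
  rw [sum_halfStep_quadratic, hsum]
  linarith

theorem integrableOn_of_integrableOn_sq {h : ℝ → ℝ} (hm : Measurable h)
    (hsq : IntegrableOn (fun t => h t ^ 2) (Ioc 0 1)) : IntegrableOn h (Ioc 0 1) := by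
  have h1 : IntegrableOn (fun _ : ℝ => (1 : ℝ)) (Ioc 0 1) := by simp
  refine Integrable.mono' (h1.add hsq) hm.aestronglyMeasurable
    (Filter.Eventually.of_forall fun t => ?_)
  simp only [Pi.add_apply, Real.norm_eq_abs]
  nlinarith [sq_nonneg (|h t| - 1), sq_abs (h t), abs_nonneg (h t)]

theorem extendReal_coe (f : unitInterval → ℝ) (x : unitInterval) : extendReal f x = f x :=
  IccExtend_val _ _ _

/-- The norm bound for the functions of the Sobolev ball. -/
theorem absKernel_normSqLe_of_mem_sobolevBall {f : unitInterval → ℝ} (hf : f ∈ sobolevBall 1) :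
    (absKernel 1).NormSqLe f 3 := by
  obtain ⟨hcont, hB, hdiff, hsq, hle⟩ := hf
  have hext : Continuous (extendReal f) := hcont.Icc_extend'
  have hsq' : IntegrableOn (fun t => deriv (extendReal f) t ^ 2) (Ioc 0 1) :=
    hsq.congr_set_ae Ioo_ae_eq_Ioc.symm
  have hh := integrableOn_of_integrableOn_sq (measurable_deriv _) hsq'
  have hnonneg : 0 ≤ ∫ t in Ioo (0 : ℝ) 1, extendReal f t ^ 2 :=
    integral_nonneg fun t => sq_nonneg _
  refine absKernel_normSqLe one_pos hh hsq' (fun x => ?_) hB ?_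
  · rw [← intervalIntegral.integral_of_le x.2.1,
      intervalIntegral.integral_eq_sub_of_hasDerivAt_of_le x.2.1 hext.continuousOn (fun t ht => ?_)
        ((intervalIntegrable_iff_integrableOn_Ioc_of_le x.2.1).mpr
          (hh.mono_set (Ioc_subset_Ioc_right x.2.2))),
      extendReal_coe]
    · congr 1
      exact extendReal_coe f 0
    · exact (hdiff.differentiableAt
        (Ioo_mem_nhds ht.1 (ht.2.trans_le x.2.2))).hasDerivAt
  · rw [integral_Ioc_eq_integral_Ioo]
    norm_num at hle ⊢
    linarith

/-- The norm bound for a bounded Lipschitz function, which is absolutely continuous and hence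
the integral of its almost everywhere defined derivative. -/
theorem absKernel_normSqLe_of_lipschitz {a : ℕ} (ha : 0 < a) {f : unitInterval → ℝ} {K : NNReal}
    {B D : ℝ} (hf : LipschitzWith K f) (hB : ∀ x, |f x| ≤ B)
    (hD : 2 * B ^ 2 + (K : ℝ) ^ 2 ≤ a * D) : (absKernel a).NormSqLe f D := by
  have hext : LipschitzWith K (extendReal f) := by
    have := hf.comp (LipschitzWith.projIcc (zero_le_one (α := ℝ)))
    rwa [mul_one] at this
  have hderiv : ∀ t, |deriv (extendReal f) t| ≤ K := fun t => norm_deriv_le_of_lipschitz hext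
  have hderiv2 : ∀ t, deriv (extendReal f) t ^ 2 ≤ (K : ℝ) ^ 2 := fun t =>
    sq_le_sq.mpr ((hderiv t).trans (le_abs_self _))
  have hsq : IntegrableOn (fun t => deriv (extendReal f) t ^ 2) (Ioc 0 1) :=
    Integrable.of_bound ((measurable_deriv _).pow_const 2).aestronglyMeasurable ((K : ℝ) ^ 2)
      (Filter.Eventually.of_forall fun t => by
        rw [Real.norm_eq_abs, abs_of_nonneg (sq_nonneg _)]
        exact hderiv2 t)
  refine absKernel_normSqLe ha (integrableOn_of_integrableOn_sq (measurable_deriv _) hsq) hsq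
    (fun x => ?_) hB ?_
  · rw [← intervalIntegral.integral_of_le x.2.1,
      (hext.lipschitzOnWith (s := uIcc 0 (x : ℝ))).absolutelyContinuousOnInterval
        |>.integral_deriv_eq_sub, extendReal_coe]
    congr 1
    exact extendReal_coe f 0
  · refine le_trans ?_ hD
    gcongr
    calc ∫ t in Ioc (0 : ℝ) 1, deriv (extendReal f) t ^ 2
        ≤ ∫ _ in Ioc (0 : ℝ) 1, (K : ℝ) ^ 2 := integral_mono hsq (by simp) hderiv2
      _ = (K : ℝ) ^ 2 := by simp

/-! ### Optimal decisions for proper and for strongly convex losses -/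

theorem risk_sub_risk (l : Loss) (p q z : unitInterval) :
    risk l q z - risk l p z = ((q : ℝ) - p) * discDeriv l z := by
  simp only [risk, discDeriv]
  ring

/-- For a proper loss with continuous discrete derivative, `∂ℓ ∘ π_ℓ` does not depend on the choice
of `π_ℓ`. Both `∂ℓ p` and `∂ℓ z` are supergradients at `p` of the concave function
`p ↦ min_z risk l p z`; one of the two inequalities between them is monotonicity, the other one
comes from the supergradients `∂ℓ q`, with `q` tending to `p` from the side of `z`. -/
theorem discDeriv_eq_of_mem_argminRisk {l : Loss} (hproper : ∀ p, p ∈ argminRisk l p)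
    (hcont : Continuous (discDeriv l)) {p z : unitInterval} (hz : z ∈ argminRisk l p) :
    discDeriv l z = discDeriv l p := by
  have key : ∀ q : unitInterval, 0 ≤ ((q : ℝ) - p) * (discDeriv l z - discDeriv l q) := fun q => by
    linarith [hz q, hproper q z, risk_sub_risk l p q z, risk_sub_risk l p q q]
  have mono : ((z : ℝ) - p) * (discDeriv l z - discDeriv l p) ≤ 0 := by
    linarith [hproper p z, hproper z p, risk_sub_risk l p z z, risk_sub_risk l p z p]
  rcases lt_trichotomy p z with hpz | rfl | hpz
  · have hpz' : (0 : ℝ) < z - p := sub_pos.mpr hpz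
    have := nhdsGT_neBot_of_exists_gt ⟨z, hpz⟩
    refine le_antisymm (by nlinarith) ?_
    refine le_of_tendsto (hcont.continuousWithinAt (s := Ioi p)) ?_
    filter_upwards [self_mem_nhdsWithin] with q hq
    have hq' : (0 : ℝ) < q - p := sub_pos.mpr hq
    exact sub_nonneg.mp (nonneg_of_mul_nonneg_right (key q) hq')
  · rfl
  · have hpz' : (0 : ℝ) < p - z := sub_pos.mpr hpz
    have := nhdsLT_neBot_of_exists_lt ⟨z, hpz⟩
    refine le_antisymm ?_ (by nlinarith)
    refine ge_of_tendsto (hcont.continuousWithinAt (s := Iio p)) ?_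
    filter_upwards [self_mem_nhdsWithin] with q hq
    have hq' : (0 : ℝ) < p - q := sub_pos.mpr hq
    nlinarith [key q]

theorem lossPS_normSqLe {l : Loss} (hl : l ∈ lossPS) {w : unitInterval → unitInterval}
    (hw : ∀ p, w p ∈ argminRisk l p) : (absKernel 1).NormSqLe (fun p => discDeriv l (w p)) 3 := by
  have : (fun p => discDeriv l (w p)) = discDeriv l :=
    funext fun p => discDeriv_eq_of_mem_argminRisk hl.1 hl.2.1 (hw p)
  rw [this]
  exact absKernel_normSqLe_of_mem_sobolevBall hl.2

theorem abs_sub_le_of_abs_deriv_le_one {f : unitInterval → ℝ} (hcont : Continuous f)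
    (hdiff : DifferentiableOn ℝ (extendReal f) (Ioo 0 1))
    (hderiv : ∀ t ∈ Ioo (0 : ℝ) 1, |deriv (extendReal f) t| ≤ 1) (y z : unitInterval) :
    |f y - f z| ≤ |(y : ℝ) - z| := by
  wlog hyz : (z : ℝ) < y generalizing y z
  · rcases (not_lt.mp hyz).eq_or_lt with h | h
    · simp [Subtype.ext h]
    · rw [abs_sub_comm, abs_sub_comm (y : ℝ)]
      exact this z y h
  have hsub : Ioo (z : ℝ) y ⊆ Ioo 0 1 := Ioo_subset_Ioo z.2.1 y.2.2
  obtain ⟨t, ht, hslope⟩ := exists_deriv_eq_slope (extendReal f) hyz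
    hcont.Icc_extend'.continuousOn (hdiff.mono hsub)
  have hpos : (0 : ℝ) < y - z := sub_pos.mpr hyz
  have h1 := hderiv t (hsub ht)
  rwa [hslope, extendReal_coe, extendReal_coe, abs_div, div_le_one (abs_pos.mpr hpos.ne')] at h1

theorem abs_discDeriv_sub_le {γ : ℝ} {l : Loss} (hl : l ∈ lossSC γ) (y z : unitInterval) :
    |discDeriv l y - discDeriv l z| ≤ 2 * |(y : ℝ) - z| := by
  have h : ∀ b, |l y b - l z b| ≤ |(y : ℝ) - z| := fun b =>
    abs_sub_le_of_abs_deriv_le_one (hl b).1 (hl b).2.2.2.1 (hl b).2.2.2.2 y z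
  calc |discDeriv l y - discDeriv l z| = |(l y true - l z true) - (l y false - l z false)| := by
        simp only [discDeriv]; congr 1; ring
    _ ≤ |l y true - l z true| + |l y false - l z false| := abs_sub _ _
    _ ≤ 2 * |(y : ℝ) - z| := by linarith [h true, h false]

/-- Quadratic growth of the risk at its minimizer. -/
theorem sq_le_risk_sub_risk {γ : ℝ} {l : Loss} (hl : l ∈ lossSC γ)
    {p z : unitInterval} (hz : z ∈ argminRisk l p) (y : unitInterval) :
    γ / 2 * ((y : ℝ) - z) ^ 2 ≤ risk l p y - risk l p z := by
  have hconv : ∀ a b : ℝ, 0 < a → 0 < b → a + b = 1 →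
      a * (γ / 2 * ((y : ℝ) - z) ^ 2) ≤ risk l p y - risk l p z := by
    intro a b ha hb hab
    have hmem : a * (z : ℝ) + b * y ∈ Icc (0 : ℝ) 1 :=
      convex_Icc (0 : ℝ) 1 z.2 y.2 ha.le hb.le hab
    have hpt : ∀ c, l ⟨_, hmem⟩ c ≤
        a * l z c + b * l y c - a * b * (γ / 2 * ((y : ℝ) - z) ^ 2) := by
      intro c
      have h := (hl c).2.2.1.2 z.2 y.2 ha.le hb.le hab
      simp only [smul_eq_mul, extendReal_coe, Real.norm_eq_abs, sq_abs] at h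
      rw [← extendReal_coe (fun yhat => l yhat c) ⟨_, hmem⟩]
      refine h.trans (le_of_eq ?_)
      ring
    have h1 : risk l p z ≤ risk l p ⟨_, hmem⟩ := hz _
    have h2 : risk l p ⟨_, hmem⟩ ≤
        a * risk l p z + b * risk l p y - a * b * (γ / 2 * ((y : ℝ) - z) ^ 2) := by
      have ht := mul_le_mul_of_nonneg_left (hpt true) p.2.1
      have hf := mul_le_mul_of_nonneg_left (hpt false) (sub_nonneg.mpr p.2.2)
      simp only [risk] at *
      linarith
    have h3 : b * (a * (γ / 2 * ((y : ℝ) - z) ^ 2)) ≤ b * (risk l p y - risk l p z) := by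
      have : a = 1 - b := by linarith
      subst this
      linarith
    exact le_of_mul_le_mul_left h3 hb
  -- let the weight `a` of the minimizer tend to one
  by_contra! hlt
  set Q := γ / 2 * ((y : ℝ) - z) ^ 2
  set Δ := risk l p y - risk l p z
  have hΔ : 0 ≤ Δ := sub_nonneg.mpr (hz y)
  have hQ : 0 < Q := hΔ.trans_lt hlt
  have h := hconv ((Δ + Q) / (2 * Q)) ((Q - Δ) / (2 * Q)) (by positivity)
    (div_pos (by linarith) (by positivity)) (by field_simp; ring)
  have : (Δ + Q) / (2 * Q) * Q = (Δ + Q) / 2 := by field_simp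
  linarith

/-- The optimal decision for a strongly convex loss depends on `p` in a Lipschitz way. -/
theorem abs_sub_le_of_mem_argminRisk {γ : ℝ} {l : Loss} (hl : l ∈ lossSC γ)
    {p q z w : unitInterval} (hz : z ∈ argminRisk l p) (hw : w ∈ argminRisk l q) :
    γ * |(z : ℝ) - w| ≤ 2 * |(p : ℝ) - q| := by
  have h1 := sq_le_risk_sub_risk hl hz w
  have h2 := sq_le_risk_sub_risk hl hw z
  have h3 : γ * |(z : ℝ) - w| ^ 2 ≤ ((p : ℝ) - q) * (discDeriv l w - discDeriv l z) := by
    rw [sq_abs]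
    linarith [risk_sub_risk l q p w, risk_sub_risk l q p z]
  have h4 : ((p : ℝ) - q) * (discDeriv l w - discDeriv l z) ≤
      |(p : ℝ) - q| * (2 * |(z : ℝ) - w|) := by
    refine (le_abs_self _).trans ?_
    rw [abs_mul, abs_sub_comm (z : ℝ)]
    gcongr
    exact abs_discDeriv_sub_le hl w z
  rcases (abs_nonneg ((z : ℝ) - w)).eq_or_lt with h | h
  · rw [← h]
    simp
  · refine le_of_mul_le_mul_right ?_ h
    linarith

theorem lossSC_normSqLe {γ : ℝ} (hγ : 0 < γ) {l : Loss} (hl : l ∈ lossSC γ)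
    {w : unitInterval → unitInterval} (hw : ∀ p, w p ∈ argminRisk l p) :
    (absKernel 4).NormSqLe (fun p => discDeriv l (w p)) (4 * γ⁻¹ ^ 2 + 2) := by
  have hK : ((4 / γ).toNNReal : ℝ) = 4 / γ := Real.coe_toNNReal _ (by positivity)
  refine absKernel_normSqLe_of_lipschitz (by norm_num) (K := (4 / γ).toNNReal) (B := 2)
    (LipschitzWith.of_dist_le_mul fun p q => ?_) (fun p => ?_) ?_
  · rw [hK, Real.dist_eq, Subtype.dist_eq, Real.dist_eq]
    refine (abs_discDeriv_sub_le hl _ _).trans ?_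
    have h := abs_sub_le_of_mem_argminRisk hl (hw p) (hw q)
    rw [div_mul_eq_mul_div, le_div_iff₀ hγ]
    linarith
  · calc |discDeriv l (w p)| ≤ |l (w p) true| + |l (w p) false| := abs_sub _ _
      _ ≤ 2 := by linarith [(hl true).2.1 (w p), (hl false).2.1 (w p)]
  · rw [hK]
    push_cast
    field_simp
    ring_nf
    rfl

/-! ### The kernel of a finite family of functions -/

theorem sum_family_quadratic {X : Type*} {m n : ℕ} (f : Fin m → X → ℝ) (x : Fin n → X)
    (c : Fin n → ℝ) :
    ∑ i, ∑ i', c i * c i' * ∑ j, f j (x i) * f j (x i') = ∑ j, (∑ i, c i * f j (x i)) ^ 2 := by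
  simp_rw [sq, Finset.sum_mul_sum]
  rw [Finset.sum_comm (s := (Finset.univ : Finset (Fin m)))]
  refine Finset.sum_congr rfl fun i _ => ?_
  rw [Finset.sum_comm]
  refine Finset.sum_congr rfl fun i' _ => ?_
  rw [Finset.mul_sum]
  exact Finset.sum_congr rfl fun j _ => by ring

/-- The kernel `∑ j, f j x * f j y`, whose feature map is `x ↦ (f j x)_j`. -/
def familyKernel {X : Type*} {m : ℕ} (f : Fin m → X → ℝ) : PDKernel X where
  toFun x y := ∑ j, f j x * f j y
  symm x y := Finset.sum_congr rfl fun j _ => mul_comm _ _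
  psd n x c := by
    rw [sum_family_quadratic]
    positivity

theorem familyKernel_apply {X : Type*} {m : ℕ} (f : Fin m → X → ℝ) (x y : X) :
    familyKernel f x y = ∑ j, f j x * f j y := rfl

theorem familyKernel_normSqLe {X : Type*} {m : ℕ} (f : Fin m → X → ℝ) (j : Fin m) :
    (familyKernel f).NormSqLe (f j) 1 := by
  intro n x c
  simp only [familyKernel_apply]
  rw [sum_family_quadratic]
  have : (∑ i, c i * f j (x i)) ^ 2 ≤ ∑ j, (∑ i, c i * f j (x i)) ^ 2 :=
    Finset.single_le_sum (f := fun j => (∑ i, c i * f j (x i)) ^ 2) (fun _ _ => sq_nonneg _)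
      (Finset.mem_univ j)
  nlinarith [sq_nonneg (∑ i, c i * f j (x i) - 1)]

theorem familyKernel_diag_le {X : Type*} {m : ℕ} {f : Fin m → X → ℝ} {M : ℝ}
    (hf : ∀ j x, |f j x| ≤ M) (x : X) : familyKernel f x x ≤ m * M ^ 2 := by
  rw [familyKernel_apply]
  refine (Finset.sum_le_card_nsmul _ _ (M ^ 2) fun j _ => ?_).trans (by simp)
  rw [← sq, ← sq_abs]
  gcongr
  exact hf j x

theorem absKernel_diag (a : ℕ) (x : unitInterval) : absKernel a x x = a * (3 / 4) := by
  simp [absKernel_apply]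

/-! ### Programs for the kernels -/

/-- A program for `absKernel a`. -/
def absProg (a : ℕ) : Prog :=
  .mul (.const a) (.sub (.const (3 / 4))
    (.div (.ifLe .argL .argR (.sub .argR .argL) (.sub .argL .argR)) (.const 2)))

theorem absProg_run (a : ℕ) {m : ℕ} (l : Fin m → Loss) (w : Fin m → unitInterval → unitInterval)
    (p q : ℝ) (i : Option (Fin m)) :
    (absProg a).run l w p q i = (a * (3 / 4 - |p - q| / 2), 12) := by
  by_cases h : p ≤ q
  · simp [absProg, Prog.run, h, abs_of_nonpos (sub_nonpos.mpr h)]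
  · simp [absProg, Prog.run, h, abs_of_nonneg (sub_nonneg.mpr (le_of_not_ge h))]

theorem absKernel_computableInSteps (a : ℕ) {N : ℕ} (hN : 12 ≤ N) :
    ComputableInSteps (absKernel a) N :=
  ⟨absProg a, fun p q => by rw [absProg_run]; exact ⟨rfl, hN⟩⟩

/-- A program for `∂ℓ (π_ℓ a)`, where `ℓ` is the current loss of the loop. -/
def composedProg (a : Prog) : Prog := .sub (.loss true (.post a)) (.loss false (.post a))

/-- A program for the kernel of the family `∂ℓ_i ∘ π_{ℓ_i}`. -/
def familyProg : Prog := .sumLosses (.mul (composedProg .argL) (composedProg .argR))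

theorem familyProg_run {m : ℕ} (l : Fin m → Loss) (w : Fin m → unitInterval → unitInterval)
    (p q : unitInterval) :
    familyProg.run l w p q none =
      (familyKernel (fun i x => discDeriv (l i) (w i x)) p q, 16 * m + 1) := by
  simp [familyProg, composedProg, Prog.run, clamp, familyKernel_apply, discDeriv, mul_comm]

/-- A program for the sum of the three kernels. -/
def sumProg : Prog := .add (.add (absProg 1) (absProg 4)) familyProg

theorem sumProg_run {m : ℕ} (l : Fin m → Loss) (w : Fin m → unitInterval → unitInterval)
    (p q : unitInterval) :
    sumProg.run l w p q none =
      ((absKernel 1 + absKernel 4 + familyKernel fun i x => discDeriv (l i) (w i x)) p q,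
        16 * m + 27) := by
  simp only [sumProg, Prog.run, absProg_run, familyProg_run, PDKernel.add_apply, absKernel_apply]
  congr 1
  ring

end KernelOI

end

theorem proposition4p2 :
    ∃ (kPS kSC : PDKernel unitInterval) (Pm Psum : Prog) (C : ℕ),
      -- the first two kernels are computed in a constant number of steps
      ComputableInSteps kPS C ∧ ComputableInSteps kSC C ∧
      -- (1) smooth proper scoring rules
      (∀ π : Loss → unitInterval → unitInterval, IsPostProcessing π lossPS →
        KDOI kPS lossPS π √3) ∧
      -- (2) strongly convex losses
      (∀ γ : ℝ, 0 < γ → ∀ π : Loss → unitInterval → unitInterval,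
        IsPostProcessing π (lossSC γ) →
          KDOI kSC (lossSC γ) π (2 * √3 * (3 + 2 * γ⁻¹))) ∧
      -- (3) finitely many bounded losses
      (∀ m : ℕ, 1 ≤ m → ∀ (l : Fin m → Loss) (π : Loss → unitInterval → unitInterval),
        IsPostProcessing π (Set.range l) →
        ∀ M : ℝ, (∀ i yhat, |discDeriv (l i) yhat| ≤ M) →
        ∃ km : PDKernel unitInterval,
          Pm.Computes l (fun i => π (l i)) km (C * m) ∧
          KDOI km (Set.range l) π (M * √m) ∧
          (M ≤ √m → KDOI km (Set.range l) π m) ∧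
          -- the sum kernel, for the union of the three classes
          Psum.Computes l (fun i => π (l i)) (kPS + kSC + km) (C * m) ∧
          (M ≤ 2 → ∀ γ : ℝ, 0 < γ →
            IsPostProcessing π (lossPS ∪ lossSC γ ∪ Set.range l) →
            KDOI (kPS + kSC + km) (lossPS ∪ lossSC γ ∪ Set.range l) π
              (4 * √(3 * m) * (2 + γ⁻¹)))) := by
  -- `43` comes from the `16 m + 27` steps of `sumProg`, as `m ≥ 1`
  refine ⟨absKernel 1, absKernel 4, familyProg, sumProg, 43,
    absKernel_computableInSteps 1 (by norm_num), absKernel_computableInSteps 4 (by norm_num),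
    fun π hπ => ?_, fun γ hγ π hπ => ?_, fun m hm l π _ M hM => ?_⟩
  · refine KDOI.of_normSqLe (fun l hl => lossPS_normSqLe hl (hπ l hl)) (by norm_num)
      (fun p => (absKernel_diag 1 p).le) (Real.sqrt_nonneg 3) ?_
    rw [Real.sq_sqrt (by norm_num)]
    norm_num
  · refine KDOI.of_normSqLe (fun l hl => lossSC_normSqLe hγ hl (hπ l hl)) (by positivity)
      (fun p => (absKernel_diag 4 p).le) (by positivity) ?_
    have hγ' : 0 < γ⁻¹ := inv_pos.mpr hγ
    rw [mul_pow, mul_pow, Real.sq_sqrt (by norm_num)]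
    push_cast
    nlinarith
  · have hm' : (1 : ℝ) ≤ m := by exact_mod_cast hm
    have hM0 : 0 ≤ M := (abs_nonneg _).trans (hM ⟨0, hm⟩ 0)
    set f : Fin m → unitInterval → ℝ := fun i x => discDeriv (l i) (π (l i) x)
    have hmem : ∀ l' ∈ Set.range l,
        (familyKernel f).NormSqLe (fun p => discDeriv l' (π l' p)) 1 := by
      rintro _ ⟨i, rfl⟩
      exact familyKernel_normSqLe f i
    have hdiag : ∀ p, familyKernel f p p ≤ m * M ^ 2 := familyKernel_diag_le fun i x => hM i _
    have hkdoi : ∀ B, M * √m ≤ B → KDOI (familyKernel f) (Set.range l) π B := fun B hB => by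
      have h0 : 0 ≤ M * √m := by positivity
      refine KDOI.of_normSqLe hmem zero_le_one hdiag (h0.trans hB) ?_
      calc 1 * (m * M ^ 2) = (M * √m) ^ 2 := by
            rw [mul_pow, Real.sq_sqrt (by positivity)]
            ring
        _ ≤ B ^ 2 := by gcongr
    refine ⟨familyKernel f, fun p q => ?_, hkdoi _ le_rfl, fun h => hkdoi _ ?_, fun p q => ?_,
      fun hM2 γ hγ hπ => ?_⟩
    · rw [familyProg_run]
      exact ⟨rfl, by simp only; omega⟩
    · calc M * √m ≤ √m * √m := by gcongr
        _ = m := Real.mul_self_sqrt (by positivity)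
    · rw [sumProg_run]
      exact ⟨rfl, by simp only; omega⟩
    · have hγ' : 0 < γ⁻¹ := inv_pos.mpr hγ
      refine KDOI.of_normSqLe (D := 4 * γ⁻¹ ^ 2 + 3) (S := 31 / 4 * m) ?_ (by positivity)
        (fun p => ?_) (by positivity) ?_
      · rintro l' ((hl | hl) | hl)
        · exact (((lossPS_normSqLe hl (hπ l' (.inl (.inl hl)))).add_right _).add_right _).mono
            (by nlinarith)
        · exact (((lossSC_normSqLe hγ hl (hπ l' (.inl (.inr hl)))).add_left _).add_right _).mono
            (by linarith)
        · exact ((hmem l' hl).add_left _).mono (by nlinarith)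
      · have h4 : m * M ^ 2 ≤ m * 2 ^ 2 := by gcongr
        simp only [PDKernel.add_apply, absKernel_diag]
        push_cast
        linarith [hdiag p]
      · rw [mul_pow, mul_pow, Real.sq_sqrt (by positivity)]
        have : 0 ≤ m * (17 * γ⁻¹ ^ 2 + 192 * γ⁻¹ + (192 - 93 / 4)) := by positivity
        linarith
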